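/- Let $\Sigma$ be a finite tape alphabet with a blank symbol $b\in\Sigma$, $Q$ a finite set of states with $|Q|>1$ and a fixed initial state $\mathrm{init}\in Q$, and let $\Delta X$ denote the simplex of probability distributions on a finite set $X$. Let $$W=\prod_{(\sigma,q)\in\Sigma\times Q}\Delta\Sigma\times\Delta Q\times\Delta\{L,S,R\}\subseteq\mathbb R^d$$ with coordinates $x^{\sigma,q}_{\sigma'},y^{\sigma,q}_{q'},z^{\sigma,q}_{d}$ (the probabilities of writing $\sigma'$, entering $q'$ and moving in direction $d$ when $\sigma$ is read in state $q$), and let $\partial W$ be the set of points of $W$ at which at least one of these coordinates vanishes. Let $\mathcal U$ be the staged pseudo-UTM simulating machines with alphabet $\Sigma$ and states $Q$. It has tape alphabet $\Sigma\sqcup Q\sqcup\{L,S,R\}\sqcup\{X,\square\}$ and four tapes: a description tape $X\,\sigma_1q_1\sigma_1'q_1'd_1\cdots\sigma_Nq_N\sigma_N'q_N'd_N\,X$ listing one tuple for each of the $N=|\Sigma||Q|$ pairs $(\sigma,q)$, in any fixed order; a staging tape $XXX$; a state tape holding the simulated state; and a working tape. In each period of $10N+5$ steps it passes through the tuples from left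 to right and compares $\sigma_i$ and $q_i$ with the symbol under the working head and with the state tape; if both agree, it copies $\sigma_i',q_i',d_i$ to the staging tape. It then writes the staged symbol and state on the working and state tapes, moves the working head in the staged direction (an entry $X$ meaning no change), resets the staging tape to $XXX$, and rewinds the description tape. The smooth relaxation of a Turing machine acts on configurations in which the state and each tape square (indexed relative to the head) carry a probability distribution. In each step the joint distribution of the state and of the symbols under the heads is taken to be the product of their distributions. From it one computes the distributions of the next state and, for each tape, of the written symbol $\mathrm{Wr}$ and of the head movement $\mathrm{Mv}\in\{-1,0,1\}$ (left, stay, right). The new distribution of square $u$ is $$P(Y_u'=\gamma)=\sum_{d}P(\mathrm{Mv}=d)\cdot\begin{cases}P(\mathrm{Wr}=\gamma)&u+d=0,\\P(Y_{u+d}=\gamma)&u+d\ne0.\end{cases}$$ For $x\in\Sigma^*$, $w\in W$ and $t\ge0$, let $\Delta\mathrm{step}^t(x,w)\in\Delta Q$ be the distribution on the state tape after $t$ periods of the smooth relaxation of $\mathcal U$, when initially the entries $\sigma_i',q_i',d_i$ of the description tape carry the distributions given by $w$, the working tape carries $x$ (starting at the head, and blank $b$ elsewhere) and the state tape carries $\mathrm{init}$.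 Fix $t\ge1$ and put $p(y|x,w)=\Delta\mathrm{step}^t(x,w)_y$. Let $q(x,y)$ be a probability distribution on $\Sigma^*\times Q$ which is deterministic, that is, there is $f:\Sigma^*\to Q$ with $q(f(x)|x)=1$ whenever $q(x)>0$, and whose input marginal $q(x)$ is uniform on a finite set $\mathcal X\subseteq\Sigma^*$, that is, constant on $\mathcal X$ and zero outside $\mathcal X$. Let $$K(w)=\sum_{x}q(x)\,D_{KL}\big(q(\cdot|x)\,\big\|\,p(\cdot|x,w)\big)\in[0,\infty],\qquad W_0=\{w\in W: K(w)=0\}.$$ Then $W_0$ is a semi-algebraic subset of $\mathbb R^d$, and $W_0\subseteq\partial W$. -/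

import Mathlib

open scoped ENNReal

namespace Synthesis

/-! ### Multi-tape Turing machines and their smooth relaxation -/

/-- The directions in which a tape head can move: left, stay, right. -/
inductive Dir
  | L
  | S
  | R
  deriving DecidableEq

instance : Fintype Dir where
  elems := {.L, .S, .R}
  complete s := by cases s <;> decide

/-- The displacement of the head belonging to a direction. -/
def Dir.shift : Dir → ℤ
  | .L => -1
  | .S => 0
  | .R => 1

/-- A deterministic Turing machine with tapes indexed by `κ`, tape alphabet `Γ` and set of states
`S`. In state `s`, reading the symbol `r k` on each tape `k`, it enters the state `next s r`, writes
`write s r k` on each tape `k` and then moves the head of tape `k` in the direction `move s r k`. -/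
structure Machine (κ Γ S : Type*) where
  next : S → (κ → Γ) → S
  write : S → (κ → Γ) → κ → Γ
  move : S → (κ → Γ) → κ → Dir

/-- A smooth configuration: `tape k u γ` is the probability that the square of tape `k` in position
`u` relative to the head contains `γ`, and `state s` is the probability of the state `s`. The type
`R` of values is `ℝ` in all uses below; only sums and products of values are ever formed. -/
@[ext]
structure SmoothConfig (κ Γ S R : Type*) where
  tape : κ → ℤ → Γ → R
  state : S → R

section SmoothStep

variable {κ Γ S R : Type*} [Fintype κ] [DecidableEq κ] [Fintype Γ] [DecidableEq Γ] [Fintype S]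
  [DecidableEq S] [CommSemiring R]

/-- The probability of being in state `s` and reading the symbols `r` under the heads, where the
state and the contents of the squares are treated as independent. -/
def SmoothConfig.prob (C : SmoothConfig κ Γ S R) (s : S) (r : κ → Γ) : R :=
  C.state s * ∏ k, C.tape k 0 (r k)

/-- The probability that the next state is `s`. -/
def Machine.probNext (M : Machine κ Γ S) (C : SmoothConfig κ Γ S R) (s : S) : R :=
  ∑ s' : S, ∑ r : κ → Γ, if M.next s' r = s then C.prob s' r else 0

/-- The probability that `γ` is written on tape `k`. -/
def Machine.probWrite (M : Machine κ Γ S) (C : SmoothConfig κ Γ S R) (k : κ) (γ : Γ) : R :=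
  ∑ s' : S, ∑ r : κ → Γ, if M.write s' r k = γ then C.prob s' r else 0

/-- The probability that the head of tape `k` moves in direction `d`. -/
def Machine.probMove (M : Machine κ Γ S) (C : SmoothConfig κ Γ S R) (k : κ) (d : Dir) : R :=
  ∑ s' : S, ∑ r : κ → Γ, if M.move s' r k = d then C.prob s' r else 0

/-- One step of the smooth relaxation of `M`: the square in relative position `u` after a move in
direction `d` is the one which was in relative position `u + d.shift` before. -/
def Machine.smoothStep (M : Machine κ Γ S) (C : SmoothConfig κ Γ S R) : SmoothConfig κ Γ S R where
  tape k u γ := ∑ d : Dir, M.probMove C k d *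
    (if u + d.shift = 0 then M.probWrite C k γ else C.tape k (u + d.shift) γ)
  state s := M.probNext C s

end SmoothStep

/-! ### The staged pseudo-UTM -/

/-- The alphabet of the staged pseudo-UTM for simulated machines with tape alphabet `A` and set of
states `Q`: the disjoint union of `A`, `Q`, the directions, a marker `X` and a blank symbol. -/
inductive UTMSymbol (A Q : Type*)
  | sym (a : A)
  | st (q : Q)
  | dir (d : Dir)
  | X
  | blank
  deriving DecidableEq, Fintype

/-- The states of the staged pseudo-UTM. -/
inductive UTMState
  | compSymbol
  | compState
  | copySymbol
  | copyState
  | copyDir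
  | notCompState
  | notCopySymbol
  | notCopyState
  | notCopyDir
  | updateSymbol
  | updateState
  | updateDir
  | resetDescr
  deriving DecidableEq

instance : Fintype UTMState where
  elems := {.compSymbol, .compState, .copySymbol, .copyState, .copyDir, .notCompState,
    .notCopySymbol, .notCopyState, .notCopyDir, .updateSymbol,
    .updateState, .updateDir, .resetDescr}
  complete s := by cases s <;> decide

/-- The four tapes: description tape, staging tape, state tape and working tape. -/
inductive UTMTape
  | descr
  | staging
  | state
  | work
  deriving DecidableEq

instance : Fintype UTMTape where
  elems := {.descr, .staging, .state, .work}
  complete s := by cases s <;> decide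

section UTM

variable {A Q : Type*} [DecidableEq A] [DecidableEq Q]

/-- State transitions of the staged pseudo-UTM. The first two squares of each tuple on the
description tape are compared with the working tape and the state tape. If both agree, the machine
goes through the copy states, otherwise it passes over the remaining squares of the tuple. On
reaching the final `X` it updates the working and state tapes and rewinds the description tape. -/
def utmNext (s : UTMState) (r : UTMTape → UTMSymbol A Q) : UTMState :=
  match s with
  | .compSymbol =>
      if r .descr = .X then .updateSymbol
      else if r .descr = r .work then .compState else .notCompState
  | .compState => if r .descr = r .state then .copySymbol else .notCopySymbol
  | .copySymbol => .copyState
  | .copyState => .copyDir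
  | .copyDir => .compSymbol
  | .notCompState => .notCopySymbol
  | .notCopySymbol => .notCopyState
  | .notCopyState => .notCopyDir
  | .notCopyDir => .compSymbol
  | .updateSymbol => .updateState
  | .updateState => .updateDir
  | .updateDir => .resetDescr
  | .resetDescr => if r .descr = .X then .compSymbol else .resetDescr

/-- Symbols written by the staged pseudo-UTM. The copy states copy the description tape to the
staging tape. The update states reset the staging tape to `X` after copying its symbol to the
working tape (`updateSymbol`) or to the state tape (`updateState`), unless that symbol is `X`. -/
def utmWrite (s : UTMState) (r : UTMTape → UTMSymbol A Q) (k : UTMTape) : UTMSymbol A Q :=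
  match s, k with
  | .copySymbol, .staging => r .descr
  | .copyState, .staging => r .descr
  | .copyDir, .staging => r .descr
  | .updateSymbol, .staging => .X
  | .updateSymbol, .work => if r .staging = .X then r .work else r .staging
  | .updateState, .staging => .X
  | .updateState, .state => if r .staging = .X then r .state else r .staging
  | .updateDir, .staging => .X
  | _, k => r k

/-- Head movements of the staged pseudo-UTM. During the scan phase the description head moves right
in every step. The staging head rests on the middle one of its three squares between tuples; it
visits the left, middle and right square in the symbol, state and direction stages of both phases. -/
def utmMove (s : UTMState) (r : UTMTape → UTMSymbol A Q) (k : UTMTape) : Dir :=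
  match s, k with
  | .compSymbol, .descr => if r .descr = .X then .S else .R
  | .compSymbol, .staging => if r .descr = .X then .L else .S
  | .compState, .descr => .R
  | .compState, .staging => .L
  | .notCompState, .descr => .R
  | .notCompState, .staging => .L
  | .copySymbol, .descr => .R
  | .copySymbol, .staging => .R
  | .notCopySymbol, .descr => .R
  | .notCopySymbol, .staging => .R
  | .copyState, .descr => .R
  | .copyState, .staging => .R
  | .notCopyState, .descr => .R
  | .notCopyState, .staging => .R
  | .copyDir, .descr => .R
  | .copyDir, .staging => .L
  | .notCopyDir, .descr => .R
  | .notCopyDir, .staging => .L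
  | .updateSymbol, .staging => .R
  | .updateState, .staging => .R
  | .updateDir, .descr => .L
  | .updateDir, .staging => .L
  | .updateDir, .work =>
      match r .staging with
      | .dir d => d
      | _ => .S
  | .resetDescr, .descr => if r .descr = .X then .R else .L
  | _, _ => .S

/-- The staged pseudo-UTM. -/
def utm (A Q : Type*) [DecidableEq A] [DecidableEq Q] : Machine UTMTape (UTMSymbol A Q) UTMState where
  next := utmNext
  write := utmWrite
  move := utmMove

end UTM

/-! ### The parameter space -/

/-- Index set of the coordinates of the parameter space. For a pair `p = (σ, q)`, the coordinates
`(p, inl σ')`, `(p, inr (inl q'))` and `(p, inr (inr d))` give the probabilities of writing `σ'`,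
of entering the state `q'` and of moving in direction `d` when reading `σ` in state `q`. -/
abbrev Coord (A Q : Type*) : Type _ := (A × Q) × (A ⊕ Q ⊕ Dir)

/-- The space `W`, a product of simplices, inside the affine space of all coordinate vectors. -/
def paramSpace (A Q : Type*) [Fintype A] [Fintype Q] : Set (Coord A Q → ℝ) :=
  {w | ∀ p : A × Q,
    (fun a : A => w (p, .inl a)) ∈ stdSimplex ℝ A ∧
    (fun q : Q => w (p, .inr (.inl q))) ∈ stdSimplex ℝ Q ∧
    (fun d : Dir => w (p, .inr (.inr d))) ∈ stdSimplex ℝ Dir}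

/-- The boundary of `W`: the points of `W` where at least one coordinate vanishes. -/
def paramBoundary (A Q : Type*) [Fintype A] [Fintype Q] : Set (Coord A Q → ℝ) :=
  {w ∈ paramSpace A Q | ∃ i, w i = 0}

/-! ### The model -/

section Model

variable {A Q : Type*} [Fintype A] [DecidableEq A] [Fintype Q] [DecidableEq Q]
  {R : Type*} [CommSemiring R]

/-- The point distribution at `γ`. -/
def pointDist {Γ : Type*} [DecidableEq Γ] (γ : Γ) : Γ → R := fun γ' => if γ' = γ then 1 else 0

/-- A distribution on `A`, as a distribution on the alphabet of the UTM. -/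
def liftSym (f : A → R) : UTMSymbol A Q → R
  | .sym a => f a
  | _ => 0

/-- A distribution on `Q`, as a distribution on the alphabet of the UTM. -/
def liftSt (f : Q → R) : UTMSymbol A Q → R
  | .st q => f q
  | _ => 0

/-- A distribution on the directions, as a distribution on the alphabet of the UTM. -/
def liftDir (f : Dir → R) : UTMSymbol A Q → R
  | .dir d => f d
  | _ => 0

/-- The five squares `σ q P(σ') P(q') P(d)` of the tuple of `p = (σ, q)` on the description tape. -/
def tupleSquare (w : Coord A Q → R) (p : A × Q) (j : ℕ) : UTMSymbol A Q → R :=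
  match j with
  | 0 => pointDist (.sym p.1)
  | 1 => pointDist (.st p.2)
  | 2 => liftSym fun a => w (p, .inl a)
  | 3 => liftSt fun q => w (p, .inr (.inl q))
  | _ => liftDir fun d => w (p, .inr (.inr d))

/-- The description tape with code `w`: an `X` in position `-1`, then the tuples in the order given
by `e`, each occupying five squares, then another `X`; all other squares are blank. -/
def descrTape {N : ℕ} (e : Fin N ≃ A × Q) (w : Coord A Q → R) (u : ℤ) : UTMSymbol A Q → R :=
  if u = -1 ∨ u = 5 * N then pointDist .X
  else if h : 0 ≤ u ∧ u < 5 * N then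
    tupleSquare w (e ⟨(u / 5).toNat, by omega⟩) (u % 5).toNat
  else pointDist .blank

/-- The working tape with the string `x` written from the head to the right; all other squares
contain the blank symbol `b` of the simulated machine. -/
def workTape (b : A) (x : List A) (u : ℤ) : UTMSymbol A Q → R :=
  pointDist (.sym (if 0 ≤ u then x.getD u.toNat b else b))

/-- The initial configuration of the UTM on input `x` with code `w`: the staging tape is `XXX` with
the head on the second `X`, the state tape has the single square `init`. -/
def initConfig {N : ℕ} (b : A) (init : Q) (e : Fin N ≃ A × Q) (x : List A) (w : Coord A Q → R) :
    SmoothConfig UTMTape (UTMSymbol A Q) UTMState R where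
  tape
    | .descr => descrTape e w
    | .staging => fun u => pointDist (if -1 ≤ u ∧ u ≤ 1 then .X else .blank)
    | .state => fun u => pointDist (if u = 0 then .st init else .blank)
    | .work => workTape b x
  state := pointDist .compSymbol

/-- `deltaStep b init e t x w s` is the probability of the state `s` after `t` steps of the simulated
machine: the smooth relaxation of the UTM is run for `t` periods of `10 * N + 5` steps each, where
`N` is the number of tuples, and the distribution under the head of the state tape is read off. -/
def deltaStep {N : ℕ} (b : A) (init : Q) (e : Fin N ≃ A × Q) (t : ℕ) (x : List A)
    (w : Coord A Q → R) (s : Q) : R :=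
  ((utm A Q).smoothStep^[(10 * N + 5) * t] (initConfig b init e x w)).tape .state 0 (.st s)

end Model

/-! ### Synthesis problems -/

section Problem

variable {A Q : Type*} [Fintype Q]

/-- The marginal probability `q(x)`. -/
noncomputable def inputProb (q : PMF (List A × Q)) (x : List A) : ℝ≥0∞ := ∑ y, q (x, y)

/-- The conditional probability `q(y|x)` (meaningful when `q(x)` is not zero). -/
noncomputable def condProb (q : PMF (List A × Q)) (x : List A) (y : Q) : ℝ≥0∞ :=
  q (x, y) / inputProb q x

/-- The synthesis problem `q` is deterministic: `q(f(x)|x) = 1` for some function `f`. -/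
def IsDeterministic (q : PMF (List A × Q)) : Prop :=
  ∃ f : List A → Q, ∀ x, inputProb q x ≠ 0 → condProb q x (f x) = 1

/-- The distribution of inputs is uniform on the finite set `X`. -/
def IsUniformOn (q : PMF (List A × Q)) (X : Finset (List A)) : Prop :=
  ∃ c : ℝ≥0∞, (∀ x ∈ X, inputProb q x = c) ∧ ∀ x ∉ X, inputProb q x = 0

/-- The Kullback-Leibler divergence of two distributions on the finite set `Q`, with values in
`[0, ∞]`. -/
noncomputable def klDist (μ ν : Q → ℝ≥0∞) : ℝ≥0∞ :=
  letI : MeasurableSpace Q := ⊤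
  InformationTheory.klDiv (∑ y, μ y • MeasureTheory.Measure.dirac y)
    (∑ y, ν y • MeasureTheory.Measure.dirac y)

variable [Fintype A] [DecidableEq A] [DecidableEq Q]

/-- The divergence `K(w) = ∑ₓ q(x) D(q(·|x) ‖ p(·|x,w))` between the true distribution and the model
`p(y|x,w) = deltaStep b init e t x w y`. -/
noncomputable def klLoss {N : ℕ} (b : A) (init : Q) (e : Fin N ≃ A × Q) (t : ℕ)
    (q : PMF (List A × Q)) (w : Coord A Q → ℝ) : ℝ≥0∞ :=
  ∑' x, inputProb q x *
    klDist (condProb q x) (fun y => ENNReal.ofReal (deltaStep b init e t x w y))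

/-- The set `W₀` of solutions: the zeros of `K` in `W`. -/
def solutionSet {N : ℕ} (b : A) (init : Q) (e : Fin N ≃ A × Q) (t : ℕ)
    (q : PMF (List A × Q)) : Set (Coord A Q → ℝ) :=
  {w ∈ paramSpace A Q | klLoss b init e t q w = 0}

end Problem

/-- Semi-algebraic subsets of `ℝ^ι`: the smallest family of sets that contains the sets `{f > 0}` of
positivity of polynomials and is closed under finite unions, finite intersections and complements. -/
inductive IsSemialgebraic {ι : Type*} : Set (ι → ℝ) → Prop
  | pos (f : MvPolynomial ι ℝ) : IsSemialgebraic {x | 0 < MvPolynomial.eval x f}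
  | union {s t : Set (ι → ℝ)} : IsSemialgebraic s → IsSemialgebraic t → IsSemialgebraic (s ∪ t)
  | inter {s t : Set (ι → ℝ)} : IsSemialgebraic s → IsSemialgebraic t → IsSemialgebraic (s ∩ t)
  | compl {s : Set (ι → ℝ)} : IsSemialgebraic s → IsSemialgebraic sᶜ

end Synthesis

/-!
The theorem has two independent halves.

*Semi-algebraicity.* One step of the smooth relaxation only forms sums and products, so it commutes
with ring homomorphisms (`Machine.smoothStep_map`); running it with polynomial values shows that
`p(y|x,w)` is a polynomial in `w` (`exists_eval_eq_deltaStep`). The divergence of two finite measures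
vanishes only if they are equal, so `K(w) = 0` means `p(y|x,w) = q(y|x)` for all `y` and all `x` with
`q(x) ≠ 0` (`klLoss_eq_zero_iff`). There are finitely many such `x`, which leaves finitely many
polynomial conditions.

*The boundary.* If a deterministic configuration has all its entries in the support of a smooth
configuration, its successor has all its entries in the support of the next smooth configuration
(`SmoothConfig.Supports.smoothStep`), because all values are nonnegative and the deterministic
transition contributes a positive product. If no coordinate of `w` vanishes, the initial smooth
configuration supports the code of every deterministic machine, in particular of the machine which
always writes `b`, enters a prescribed state `q'` and does not move. A deterministic run of the
pseudo-UTM on this code has `q'` on the state tape after each period (`detStep_period`). So all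
states have positive probability (`deltaStep_pos`), whereas a zero of `K` gives probability zero to
all states but `f(x)`, and there is another state as `|Q| > 1`.
-/

namespace Synthesis

/-! ### Naturality of the smooth relaxation in the ring of values -/

section Naturality

variable {κ Γ S R R' : Type*} [CommSemiring R] [CommSemiring R']

/-- The smooth configuration obtained by applying a ring homomorphism to all values. -/
def SmoothConfig.map (φ : R →+* R') (C : SmoothConfig κ Γ S R) : SmoothConfig κ Γ S R' where
  tape k u γ := φ (C.tape k u γ)
  state s := φ (C.state s)

theorem Machine.smoothStep_map [Fintype κ] [DecidableEq κ] [Fintype Γ] [DecidableEq Γ] [Fintype S]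
    [DecidableEq S] (φ : R →+* R') (M : Machine κ Γ S) (C : SmoothConfig κ Γ S R) :
    M.smoothStep (C.map φ) = (M.smoothStep C).map φ := by
  have hp : ∀ s r, (C.map φ).prob s r = φ (C.prob s r) := fun s r => by
    simp [SmoothConfig.prob, SmoothConfig.map]
  ext k u γ
  · simp only [Machine.smoothStep, Machine.probMove, Machine.probWrite, hp]
    simp [SmoothConfig.map, apply_ite φ]
  · simp only [Machine.smoothStep, Machine.probNext, hp]
    simp [SmoothConfig.map, apply_ite φ]

variable {A Q : Type*} [DecidableEq A] [DecidableEq Q]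

theorem initConfig_map {N : ℕ} (φ : R →+* R') (b : A) (init : Q) (e : Fin N ≃ A × Q) (x : List A)
    (w : Coord A Q → R) :
    (initConfig b init e x w).map φ = initConfig b init e x (φ ∘ w) := by
  have hpt : ∀ γ γ' : UTMSymbol A Q, φ (pointDist γ γ') = pointDist γ γ' := fun γ γ' => by
    simp [pointDist, apply_ite φ]
  have htuple : ∀ p j γ, φ (tupleSquare w p j γ) = tupleSquare (φ ∘ w) p j γ := by
    intro p j γ
    unfold tupleSquare
    split
    · exact hpt _ _
    · exact hpt _ _
    · cases γ <;> simp [liftSym]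
    · cases γ <;> simp [liftSt]
    · cases γ <;> simp [liftDir]
  ext k u γ
  · cases k
    · simp only [SmoothConfig.map, initConfig, descrTape]
      split_ifs
      · exact hpt _ _
      · exact htuple _ _ _
      · exact hpt _ _
    · exact hpt _ _
    · exact hpt _ _
    · exact hpt _ _
  · simp [SmoothConfig.map, initConfig, pointDist, apply_ite φ]

variable [Fintype A] [Fintype Q]

theorem deltaStep_map {N : ℕ} (φ : R →+* R') (b : A) (init : Q) (e : Fin N ≃ A × Q) (t : ℕ)
    (x : List A) (w : Coord A Q → R) (s : Q) :
    φ (deltaStep b init e t x w s) = deltaStep b init e t x (φ ∘ w) s := by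
  have hiter : ∀ n, ((utm A Q).smoothStep^[n] (initConfig b init e x w)).map φ =
      (utm A Q).smoothStep^[n] (initConfig b init e x (φ ∘ w)) := by
    intro n
    induction n with
    | zero => exact initConfig_map φ b init e x w
    | succ n ih =>
      rw [Function.iterate_succ_apply', Function.iterate_succ_apply', ← ih,
        Machine.smoothStep_map]
  unfold deltaStep
  rw [← hiter]
  rfl

/-- The model depends polynomially on the parameter: run the smooth relaxation with polynomial
values, the entries of the description tape being the indeterminates. -/
theorem exists_eval_eq_deltaStep {N : ℕ} (b : A) (init : Q) (e : Fin N ≃ A × Q) (t : ℕ)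
    (x : List A) (s : Q) :
    ∃ f : MvPolynomial (Coord A Q) ℝ, ∀ w, MvPolynomial.eval w f = deltaStep b init e t x w s := by
  refine ⟨deltaStep b init e t x MvPolynomial.X s, fun w => ?_⟩
  rw [deltaStep_map]
  congr 1
  ext i
  simp

end Naturality

/-! ### Semi-algebraic sets -/

namespace IsSemialgebraic

variable {ι : Type*}

protected theorem empty : IsSemialgebraic (∅ : Set (ι → ℝ)) := by
  simpa using IsSemialgebraic.pos (0 : MvPolynomial ι ℝ)

protected theorem univ : IsSemialgebraic (Set.univ : Set (ι → ℝ)) := by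
  simpa using (IsSemialgebraic.empty (ι := ι)).compl

theorem nonpos (f : MvPolynomial ι ℝ) : IsSemialgebraic {x | MvPolynomial.eval x f ≤ 0} := by
  simpa [Set.compl_def] using (IsSemialgebraic.pos f).compl

theorem nonneg (f : MvPolynomial ι ℝ) : IsSemialgebraic {x | 0 ≤ MvPolynomial.eval x f} := by
  simpa using nonpos (-f)

theorem eq_const (f : MvPolynomial ι ℝ) (c : ℝ) :
    IsSemialgebraic {x | MvPolynomial.eval x f = c} := by
  convert (nonpos (f - .C c)).inter (nonneg (f - .C c)) using 1
  ext x
  simp [le_antisymm_iff]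

theorem forall_mem {α : Type*} (s : Finset α) {P : α → (ι → ℝ) → Prop}
    (h : ∀ a ∈ s, IsSemialgebraic {x | P a x}) : IsSemialgebraic {x | ∀ a ∈ s, P a x} := by
  classical
  induction s using Finset.induction_on with
  | empty => simpa using IsSemialgebraic.univ
  | insert a s _ ih =>
    convert (h a (by simp)).inter (ih fun a' ha' => h a' (by simp [ha'])) using 1
    ext x
    simp

theorem forall_fintype {α : Type*} [Fintype α] {P : α → (ι → ℝ) → Prop}
    (h : ∀ a, IsSemialgebraic {x | P a x}) : IsSemialgebraic {x | ∀ a, P a x} := by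
  simpa using forall_mem Finset.univ fun a _ => h a

theorem ofReal_eq_const (f : MvPolynomial ι ℝ) (c : ℝ≥0∞) :
    IsSemialgebraic {x | c = ENNReal.ofReal (MvPolynomial.eval x f)} := by
  induction c using ENNReal.recTopCoe with
  | top => simpa using IsSemialgebraic.empty
  | coe c =>
    -- `ENNReal.ofReal` truncates at `0`, so the value `0` also comes from negative numbers.
    rcases eq_or_ne c 0 with rfl | hc
    · simpa [eq_comm] using nonpos f
    · convert eq_const f c using 1
      ext x
      have hcpos : (0 : ℝ) < c := by exact_mod_cast pos_iff_ne_zero.2 hc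
      rw [Set.mem_ofPred_eq, Set.mem_ofPred_eq, ← ENNReal.ofReal_coe_nnreal (p := c),
        eq_comm (a := MvPolynomial.eval x f)]
      constructor
      · intro h
        have hpos : 0 < MvPolynomial.eval x f := by
          rw [← ENNReal.ofReal_pos, ← h]
          exact ENNReal.ofReal_pos.2 hcpos
        exact (ENNReal.ofReal_eq_ofReal_iff hcpos.le hpos.le).1 h
      · intro h
        rw [h]

theorem stdSimplex_comp {α : Type*} [Fintype α] (g : α → ι) :
    IsSemialgebraic {x : ι → ℝ | (fun a => x (g a)) ∈ stdSimplex ℝ α} := by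
  have h1 : IsSemialgebraic {x : ι → ℝ | ∀ a, 0 ≤ x (g a)} :=
    forall_fintype fun a => by simpa using nonneg (MvPolynomial.X (g a))
  have h2 : IsSemialgebraic {x : ι → ℝ | ∑ a, x (g a) = 1} := by
    simpa using eq_const (∑ a, MvPolynomial.X (g a)) 1
  exact h1.inter h2

end IsSemialgebraic

theorem isSemialgebraic_paramSpace (A Q : Type*) [Fintype A] [Fintype Q] :
    IsSemialgebraic (paramSpace A Q) :=
  IsSemialgebraic.forall_fintype fun _ => (IsSemialgebraic.stdSimplex_comp _).inter
    ((IsSemialgebraic.stdSimplex_comp _).inter (IsSemialgebraic.stdSimplex_comp _))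

/-! ### The zeros of the divergence -/

section Divergence

variable {A Q : Type*} [Fintype Q]

theorem klDist_eq_zero_iff {μ ν : Q → ℝ≥0∞} (hμ : ∀ y, μ y ≠ ∞) (hν : ∀ y, ν y ≠ ∞) :
    klDist μ ν = 0 ↔ ∀ y, μ y = ν y := by
  classical
  let _ : MeasurableSpace Q := ⊤
  have hfin : ∀ ρ : Q → ℝ≥0∞, (∀ y, ρ y ≠ ∞) →
      MeasureTheory.IsFiniteMeasure (∑ y, ρ y • MeasureTheory.Measure.dirac y) := by
    intro ρ hρ
    refine ⟨?_⟩
    simpa [MeasureTheory.Measure.finsetSum_apply, lt_top_iff_ne_top] using hρ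
  have hsingle : ∀ (ρ : Q → ℝ≥0∞) y,
      (∑ y, ρ y • MeasureTheory.Measure.dirac y : MeasureTheory.Measure Q) {y} = ρ y := by
    intro ρ y
    simp [MeasureTheory.Measure.finsetSum_apply, Set.indicator_apply]
  have := hfin μ hμ
  have := hfin ν hν
  unfold klDist
  rw [InformationTheory.klDiv_eq_zero_iff]
  constructor
  · intro h y
    rw [← hsingle μ y, h, hsingle]
  · intro h
    rw [funext h]

theorem inputProb_ne_top (q : PMF (List A × Q)) (x : List A) : inputProb q x ≠ ∞ :=
  ENNReal.sum_ne_top.2 fun _ _ => q.apply_ne_top _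

theorem condProb_ne_top (q : PMF (List A × Q)) {x : List A} (hx : inputProb q x ≠ 0) (y : Q) :
    condProb q x y ≠ ∞ :=
  ENNReal.div_ne_top (q.apply_ne_top _) hx

theorem sum_condProb (q : PMF (List A × Q)) {x : List A} (hx : inputProb q x ≠ 0) :
    ∑ y, condProb q x y = 1 := by
  simp only [condProb, div_eq_mul_inv, ← Finset.sum_mul]
  exact ENNReal.mul_inv_cancel hx (inputProb_ne_top q x)

theorem exists_inputProb_ne_zero (q : PMF (List A × Q)) : ∃ x, inputProb q x ≠ 0 := by
  obtain ⟨⟨x, y⟩, h⟩ := q.support_nonempty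
  refine ⟨x, fun h0 => (q.mem_support_iff _).1 h ?_⟩
  exact Finset.sum_eq_zero_iff.1 h0 y (Finset.mem_univ y)

theorem condProb_eq_zero (q : PMF (List A × Q)) {x : List A} (hx : inputProb q x ≠ 0) {y y' : Q}
    (hy : condProb q x y = 1) (hne : y' ≠ y) : condProb q x y' = 0 := by
  classical
  have h := sum_condProb q hx
  rw [← Finset.add_sum_erase _ _ (Finset.mem_univ y), hy] at h
  have h0 : ∑ z ∈ Finset.univ.erase y, condProb q x z = 0 :=
    (ENNReal.add_right_inj ENNReal.one_ne_top).1 (h.trans (add_zero 1).symm)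
  exact Finset.sum_eq_zero_iff.1 h0 y' (by simp [hne])

variable [Fintype A] [DecidableEq A] [DecidableEq Q]

theorem klLoss_eq_zero_iff {N : ℕ} (b : A) (init : Q) (e : Fin N ≃ A × Q) (t : ℕ)
    (q : PMF (List A × Q)) (w : Coord A Q → ℝ) :
    klLoss b init e t q w = 0 ↔ ∀ x, inputProb q x ≠ 0 → ∀ y,
      condProb q x y = ENNReal.ofReal (deltaStep b init e t x w y) := by
  simp only [klLoss, ENNReal.tsum_eq_zero, mul_eq_zero, or_iff_not_imp_left]
  refine forall_congr' fun x => imp_congr_right fun hx => ?_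
  exact klDist_eq_zero_iff (condProb_ne_top q hx) fun _ => ENNReal.ofReal_ne_top

theorem isSemialgebraic_solutionSet {N : ℕ} (b : A) (init : Q) (e : Fin N ≃ A × Q) (t : ℕ)
    (q : PMF (List A × Q)) (X : Finset (List A)) (hX : ∀ x ∉ X, inputProb q x = 0) :
    IsSemialgebraic (solutionSet b init e t q) := by
  refine (isSemialgebraic_paramSpace A Q).inter ?_
  have hset : {w : Coord A Q → ℝ | klLoss b init e t q w = 0} =
      {w | ∀ x ∈ X, inputProb q x ≠ 0 → ∀ y,
        condProb q x y = ENNReal.ofReal (deltaStep b init e t x w y)} := by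
    ext w
    simp only [Set.mem_ofPred_eq, klLoss_eq_zero_iff]
    exact ⟨fun h x _ => h x, fun h x hx => h x (by_contra fun hn => hx (hX x hn)) hx⟩
  change IsSemialgebraic {w | klLoss b init e t q w = 0}
  rw [hset]
  refine IsSemialgebraic.forall_mem X fun x _ => ?_
  by_cases hx : inputProb q x = 0
  · simpa [hx] using IsSemialgebraic.univ
  · simp only [ne_eq, hx, not_false_eq_true, true_imp_iff]
    refine IsSemialgebraic.forall_fintype fun y => ?_
    obtain ⟨f, hf⟩ := exists_eval_eq_deltaStep b init e t x y
    simpa only [hf] using IsSemialgebraic.ofReal_eq_const f (condProb q x y)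

end Divergence

/-! ### Deterministic runs in the support of the smooth relaxation -/

section Support

variable {κ Γ S : Type*}

/-- A configuration of a deterministic machine. The squares of each tape are numbered independently
of the head, whose position is `head k`. -/
@[ext]
structure DetConfig (κ Γ S : Type*) where
  state : S
  head : κ → ℤ
  tape : κ → ℤ → Γ

/-- The symbols under the heads. -/
def DetConfig.read (c : DetConfig κ Γ S) (k : κ) : Γ := c.tape k (c.head k)

/-- One step of a deterministic machine. -/
def Machine.detStep (M : Machine κ Γ S) (c : DetConfig κ Γ S) : DetConfig κ Γ S where
  state := M.next c.state c.read
  head k := c.head k + (M.move c.state c.read k).shift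
  tape k := Function.update (c.tape k) (c.head k) (M.write c.state c.read k)

/-- All values of a smooth configuration are nonnegative. -/
def SmoothConfig.Nonneg (C : SmoothConfig κ Γ S ℝ) : Prop :=
  (∀ k u γ, 0 ≤ C.tape k u γ) ∧ ∀ s, 0 ≤ C.state s

/-- The smooth configuration `C` gives positive probability to the state and to the content of each
square of the deterministic configuration `c`. -/
def SmoothConfig.Supports (C : SmoothConfig κ Γ S ℝ) (c : DetConfig κ Γ S) : Prop :=
  (∀ k u, 0 < C.tape k u (c.tape k (c.head k + u))) ∧ 0 < C.state c.state

variable [Fintype κ]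

theorem SmoothConfig.Nonneg.prob_nonneg {C : SmoothConfig κ Γ S ℝ} (hC : C.Nonneg) (s : S)
    (r : κ → Γ) : 0 ≤ C.prob s r :=
  mul_nonneg (hC.2 s) (Finset.prod_nonneg fun k _ => hC.1 k 0 (r k))

theorem SmoothConfig.Supports.prob_pos {C : SmoothConfig κ Γ S ℝ} {c : DetConfig κ Γ S}
    (h : C.Supports c) : 0 < C.prob c.state c.read :=
  mul_pos h.2 (Finset.prod_pos fun k _ => by simpa [DetConfig.read] using h.1 k 0)

variable [DecidableEq κ] [Fintype Γ] [Fintype S] {C : SmoothConfig κ Γ S ℝ}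

theorem SmoothConfig.Nonneg.sum_ite_nonneg (hC : C.Nonneg) (P : S → (κ → Γ) → Prop)
    [∀ s r, Decidable (P s r)] : 0 ≤ ∑ s, ∑ r, if P s r then C.prob s r else 0 :=
  Finset.sum_nonneg fun s _ => Finset.sum_nonneg fun r _ => by
    split_ifs
    exacts [hC.prob_nonneg s r, le_rfl]

theorem SmoothConfig.Supports.sum_ite_pos {c : DetConfig κ Γ S} (h : C.Supports c) (hC : C.Nonneg)
    (P : S → (κ → Γ) → Prop) [∀ s r, Decidable (P s r)] (hP : P c.state c.read) :
    0 < ∑ s, ∑ r, if P s r then C.prob s r else 0 := by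
  have hterm : ∀ s r, 0 ≤ if P s r then C.prob s r else 0 := fun s r => by
    split_ifs
    exacts [hC.prob_nonneg s r, le_rfl]
  refine Finset.sum_pos' (fun s _ => Finset.sum_nonneg fun r _ => hterm s r)
    ⟨c.state, Finset.mem_univ _, Finset.sum_pos' (fun r _ => hterm _ r)
      ⟨c.read, Finset.mem_univ _, ?_⟩⟩
  rw [if_pos hP]
  exact h.prob_pos

variable [DecidableEq Γ]

theorem SmoothConfig.Nonneg.smoothStep_term (hC : C.Nonneg) (M : Machine κ Γ S) (k : κ) (u : ℤ)
    (γ : Γ) (d : Dir) : 0 ≤ M.probMove C k d *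
      (if u + d.shift = 0 then M.probWrite C k γ else C.tape k (u + d.shift) γ) := by
  refine mul_nonneg (hC.sum_ite_nonneg fun s r => M.move s r k = d) ?_
  split_ifs
  exacts [hC.sum_ite_nonneg fun s r => M.write s r k = γ, hC.1 _ _ _]

variable [DecidableEq S]

theorem SmoothConfig.Nonneg.smoothStep (hC : C.Nonneg) (M : Machine κ Γ S) :
    (M.smoothStep C).Nonneg := by
  refine ⟨fun k u γ => ?_, fun s => hC.sum_ite_nonneg fun s' r => M.next s' r = s⟩
  simp only [Machine.smoothStep]
  exact Finset.sum_nonneg fun d _ => hC.smoothStep_term M k u γ d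

/-- A deterministic transition out of the support stays in the support: its contributions to the
distributions of next state, written symbols and movements are positive, and no value is
negative. -/
theorem SmoothConfig.Supports.smoothStep {c : DetConfig κ Γ S} (h : C.Supports c) (hC : C.Nonneg)
    (M : Machine κ Γ S) : (M.smoothStep C).Supports (M.detStep c) := by
  refine ⟨fun k u => ?_, h.sum_ite_pos hC (fun s r => M.next s r = _) rfl⟩
  refine Finset.sum_pos' (fun d _ => hC.smoothStep_term M k u _ d)
    ⟨M.move c.state c.read k, Finset.mem_univ _,
      mul_pos (h.sum_ite_pos hC (fun s r => M.move s r k = _) rfl) ?_⟩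
  simp only [Machine.detStep]
  split_ifs with hu
  · rw [show c.head k + (M.move c.state c.read k).shift + u = c.head k by omega,
      Function.update_self]
    exact h.sum_ite_pos hC (fun s r => M.write s r k = _) rfl
  · rw [Function.update_of_ne (by omega), add_assoc, add_comm _ u]
    exact h.1 k _

theorem SmoothConfig.Supports.iterate {c : DetConfig κ Γ S} (h : C.Supports c) (hC : C.Nonneg)
    (M : Machine κ Γ S) (n : ℕ) : (M.smoothStep^[n] C).Supports (M.detStep^[n] c) := by
  induction n generalizing C c with
  | zero => exact h
  | succ n ih => exact ih (h.smoothStep hC M) (hC.smoothStep M)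

end Support

/-! ### A deterministic period of the staged pseudo-UTM -/

section Run

variable {A Q : Type*} {N : ℕ}

/-- The description tape of the machine which always writes `b`, enters `q'` and does not move the
head. -/
def detDescr (e : Fin N ≃ A × Q) (b : A) (q' : Q) (u : ℤ) : UTMSymbol A Q :=
  if u = -1 ∨ u = 5 * N then .X
  else if h : 0 ≤ u ∧ u < 5 * N then
    match (u % 5).toNat with
    | 0 => .sym (e ⟨(u / 5).toNat, by omega⟩).1
    | 1 => .st (e ⟨(u / 5).toNat, by omega⟩).2
    | 2 => .sym b
    | 3 => .st q'
    | _ => .dir .S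
  else .blank

/-- The contents of the staging tape: `x`, `y`, `z` in the positions `-1`, `0`, `1`. -/
def stagingTape (x y z : UTMSymbol A Q) (u : ℤ) : UTMSymbol A Q :=
  if u = -1 then x else if u = 0 then y else if u = 1 then z else .blank

/-- The configuration of the staged pseudo-UTM in state `s` with description head in position `p`
and staging head in position `j`. The description tape is `D` and the staging tape `g`; `v` and `a`
stand under the heads of the state and working tapes, which remain in position `0`, and `W` is the
content of the working tape away from its head. -/
def utmConfig (D W : ℤ → UTMSymbol A Q) (s : UTMState) (p j : ℤ) (g : ℤ → UTMSymbol A Q) (v : Q)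
    (a : A) : DetConfig UTMTape (UTMSymbol A Q) UTMState where
  state := s
  head
    | .descr => p
    | .staging => j
    | .state => 0
    | .work => 0
  tape
    | .descr => D
    | .staging => g
    | .state => Function.update (fun _ => .blank) 0 (.st v)
    | .work => Function.update W 0 (.sym a)

theorem update_stagingTape_left (x y z x' : UTMSymbol A Q) :
    Function.update (stagingTape x y z) (-1) x' = stagingTape x' y z := by
  ext u
  by_cases hu : u = -1 <;> simp [stagingTape, hu]

theorem update_stagingTape_middle (x y z y' : UTMSymbol A Q) :
    Function.update (stagingTape x y z) 0 y' = stagingTape x y' z := by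
  ext u
  by_cases hu : u = 0 <;> simp [stagingTape, hu]

theorem update_stagingTape_right (x y z z' : UTMSymbol A Q) :
    Function.update (stagingTape x y z) 1 z' = stagingTape x y z' := by
  ext u
  by_cases hu : u = 1 <;> simp [stagingTape, hu]

section Descr

variable (e : Fin N ≃ A × Q) (b : A) (q' : Q)

theorem detDescr_left : detDescr e b q' (-1) = .X := by simp [detDescr]

theorem detDescr_right : detDescr e b q' (5 * N) = .X := by simp [detDescr]

theorem detDescr_tuple (i : Fin N) :
    detDescr e b q' (5 * i) = .sym (e i).1 ∧ detDescr e b q' (5 * i + 1) = .st (e i).2 ∧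
      detDescr e b q' (5 * i + 2) = .sym b ∧ detDescr e b q' (5 * i + 3) = .st q' ∧
      detDescr e b q' (5 * i + 4) = .dir .S := by
  have hi := i.2
  have key : ∀ c : ℤ, 0 ≤ c → c < 5 →
      ¬((5 * i + c : ℤ) = -1 ∨ (5 * i + c : ℤ) = 5 * N) ∧
      (0 ≤ (5 * i + c : ℤ) ∧ (5 * i + c : ℤ) < 5 * N) ∧
      ((5 * i + c : ℤ) / 5).toNat = i ∧ (5 * i + c : ℤ) % 5 = c := by
    intro c h0 h5
    omega
  refine ⟨?_, ?_, ?_, ?_, ?_⟩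
  · obtain ⟨h1, h2, h3, h4⟩ := key 0 (by norm_num) (by norm_num)
    rw [add_zero] at h1 h2 h3 h4
    simp only [detDescr, if_neg h1, dif_pos h2, h3, h4]
    rfl
  · obtain ⟨h1, h2, h3, h4⟩ := key 1 (by norm_num) (by norm_num)
    simp only [detDescr, if_neg h1, dif_pos h2, h3, h4]
    rfl
  · obtain ⟨h1, h2, h3, h4⟩ := key 2 (by norm_num) (by norm_num)
    simp only [detDescr, if_neg h1, dif_pos h2, h4]
    rfl
  · obtain ⟨h1, h2, h3, h4⟩ := key 3 (by norm_num) (by norm_num)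
    simp only [detDescr, if_neg h1, dif_pos h2, h4]
    rfl
  · obtain ⟨h1, h2, h3, h4⟩ := key 4 (by norm_num) (by norm_num)
    simp only [detDescr, if_neg h1, dif_pos h2, h4]
    rfl

theorem detDescr_ne_X {u : ℤ} (h0 : 0 ≤ u) (hN : u < 5 * N) : detDescr e b q' u ≠ .X := by
  rw [detDescr, if_neg (by omega), dif_pos ⟨h0, hN⟩]
  split <;> simp

end Descr

/-- The symbols read in the configuration `utmConfig D W s p j g v a`, where `x = D p` and
`y = g j`. -/
def utmRead (x y : UTMSymbol A Q) (v : Q) (a : A) : UTMTape → UTMSymbol A Q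
  | .descr => x
  | .staging => y
  | .state => .st v
  | .work => .sym a

variable [DecidableEq A] [DecidableEq Q]

theorem detStep_utmConfig {D W g g' : ℤ → UTMSymbol A Q} {s s' : UTMState} {p p' j j' : ℤ}
    {v v' : Q} {a a' : A} (hs : utmNext s (utmRead (D p) (g j) v a) = s')
    (hp : p + (utmMove s (utmRead (D p) (g j) v a) .descr).shift = p')
    (hj : j + (utmMove s (utmRead (D p) (g j) v a) .staging).shift = j')
    (hw : utmMove s (utmRead (D p) (g j) v a) .work = .S)
    (hg : Function.update g j (utmWrite s (utmRead (D p) (g j) v a) .staging) = g')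
    (hv : utmWrite s (utmRead (D p) (g j) v a) .state = .st v')
    (ha : utmWrite s (utmRead (D p) (g j) v a) .work = .sym a') :
    (utm A Q).detStep (utmConfig D W s p j g v a) = utmConfig D W s' p' j' g' v' a' := by
  have hread : (utmConfig D W s p j g v a).read = utmRead (D p) (g j) v a := by
    ext k
    cases k <;> simp [DetConfig.read, utmConfig, utmRead]
  have hD : utmWrite s (utmRead (D p) (g j) v a) .descr = D p := by cases s <;> rfl
  have hstate : utmMove s (utmRead (D p) (g j) v a) .state = .S := by cases s <;> rfl
  unfold Machine.detStep
  rw [hread]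
  ext k u
  · exact hs
  · cases k
    · exact hp
    · exact hj
    · simp [utm, utmConfig, hstate, Dir.shift]
    · simp [utm, utmConfig, hw, Dir.shift]
  · cases k
    · simp [utm, utmConfig, hD]
    · exact congrFun hg u
    · simp [utm, utmConfig, hv]
    · simp [utm, utmConfig, ha]

variable (e : Fin N ≃ A × Q) (b : A) (q' : Q) (W : ℤ → UTMSymbol A Q) (v : Q) (a : A)

/-- The scan of a tuple which matches the working and state tapes. -/
theorem detStep_tuple_match (i : Fin N) (hi : e i = (a, v)) (x y z : UTMSymbol A Q) :
    (utm A Q).detStep^[5]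
        (utmConfig (detDescr e b q') W .compSymbol (5 * i) 0 (stagingTape x y z) v a) =
      utmConfig (detDescr e b q') W .compSymbol (5 * i + 5) 0
        (stagingTape (.sym b) (.st q') (.dir .S)) v a := by
  obtain ⟨h0, h1, h2, h3, h4⟩ := detDescr_tuple e b q' i
  rw [hi] at h0 h1
  simp only [Function.iterate_succ_apply, Function.iterate_zero_apply]
  rw [detStep_utmConfig (s' := .compState) (p' := 5 * i + 1) (j' := 0) (g' := stagingTape x y z)
      (v' := v) (a' := a),
    detStep_utmConfig (s' := .copySymbol) (p' := 5 * i + 2) (j' := -1) (g' := stagingTape x y z)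
      (v' := v) (a' := a),
    detStep_utmConfig (s' := .copyState) (p' := 5 * i + 3) (j' := 0)
      (g' := stagingTape (.sym b) y z) (v' := v) (a' := a),
    detStep_utmConfig (s' := .copyDir) (p' := 5 * i + 4) (j' := 1)
      (g' := stagingTape (.sym b) (.st q') z) (v' := v) (a' := a),
    detStep_utmConfig]
  all_goals
    simp [utmNext, utmMove, utmWrite, utmRead, Dir.shift, h0, h1, h2, h3, h4, add_assoc,
      update_stagingTape_left, update_stagingTape_middle, update_stagingTape_right]

/-- The scan of a tuple which does not match the working and state tapes. -/
theorem detStep_tuple_of_ne (i : Fin N) (hi : e i ≠ (a, v)) (g : ℤ → UTMSymbol A Q) :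
    (utm A Q).detStep^[5] (utmConfig (detDescr e b q') W .compSymbol (5 * i) 0 g v a) =
      utmConfig (detDescr e b q') W .compSymbol (5 * i + 5) 0 g v a := by
  obtain ⟨h0, h1, -, -, -⟩ := detDescr_tuple e b q' i
  simp only [Function.iterate_succ_apply, Function.iterate_zero_apply]
  -- The paths through `compState` and `notCompState` move all heads alike and meet again in
  -- `notCopySymbol`.
  rw [detStep_utmConfig (s' := if (e i).1 = a then .compState else .notCompState)
      (p' := 5 * i + 1) (j' := 0) (g' := g) (v' := v) (a' := a),
    detStep_utmConfig (s' := .notCopySymbol) (p' := 5 * i + 2) (j' := -1) (g' := g)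
      (v' := v) (a' := a),
    detStep_utmConfig (s' := .notCopyState) (p' := 5 * i + 3) (j' := 0) (g' := g)
      (v' := v) (a' := a),
    detStep_utmConfig (s' := .notCopyDir) (p' := 5 * i + 4) (j' := 1) (g' := g)
      (v' := v) (a' := a),
    detStep_utmConfig]
  all_goals try split_ifs with ha
  all_goals
    simp [utmNext, utmMove, utmWrite, utmRead, Dir.shift, h0, h1, add_assoc]
  all_goals
    first
    | exact ha
    | exact fun hv => hi (Prod.ext ha hv)

/-- The scan of all tuples leaves the staging tape with the entries of the single matching one. -/
theorem detStep_scan :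
    (utm A Q).detStep^[5 * N]
        (utmConfig (detDescr e b q') W .compSymbol 0 0 (stagingTape .X .X .X) v a) =
      utmConfig (detDescr e b q') W .compSymbol (5 * N) 0
        (stagingTape (.sym b) (.st q') (.dir .S)) v a := by
  have key : ∀ i ≤ N, (utm A Q).detStep^[5 * i]
      (utmConfig (detDescr e b q') W .compSymbol 0 0 (stagingTape .X .X .X) v a) =
      utmConfig (detDescr e b q') W .compSymbol (5 * i) 0
        (if (e.symm (a, v) : ℕ) < i then stagingTape (.sym b) (.st q') (.dir .S)
          else stagingTape .X .X .X) v a := by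
    intro i
    induction i with
    | zero => intro _; simp
    | succ i ih =>
      intro hi
      rw [show 5 * (i + 1) = 5 + 5 * i by ring, Function.iterate_add_apply, ih (by omega),
        show (5 * ((i + 1 : ℕ) : ℤ)) = 5 * i + 5 by push_cast; ring]
      by_cases hm : e ⟨i, hi⟩ = (a, v)
      · have hidx : (e.symm (a, v) : ℕ) = i := by rw [← hm, e.symm_apply_apply]
        rw [if_neg (by omega), if_pos (by omega)]
        exact detStep_tuple_match e b q' W v a ⟨i, hi⟩ hm _ _ _
      · have hidx : (e.symm (a, v) : ℕ) ≠ i := fun h => hm (by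
          rw [← e.apply_symm_apply (a, v)]
          exact congrArg e (Fin.ext h.symm))
        simp only [show ((e.symm (a, v) : ℕ) < i + 1) = ((e.symm (a, v) : ℕ) < i) from
          propext (by omega)]
        exact detStep_tuple_of_ne e b q' W v a ⟨i, hi⟩ hm _
  rw [key N le_rfl, if_pos (e.symm (a, v)).2]

/-- The update of the working and state tapes. -/
theorem detStep_update :
    (utm A Q).detStep^[4]
        (utmConfig (detDescr e b q') W .compSymbol (5 * N) 0
          (stagingTape (.sym b) (.st q') (.dir .S)) v a) =
      utmConfig (detDescr e b q') W .resetDescr (5 * N - 1) 0 (stagingTape .X .X .X) q' b := by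
  have hX := detDescr_right e b q'
  simp only [Function.iterate_succ_apply, Function.iterate_zero_apply]
  rw [detStep_utmConfig (s' := .updateSymbol) (p' := 5 * N) (j' := -1)
      (g' := stagingTape (.sym b) (.st q') (.dir .S)) (v' := v) (a' := a),
    detStep_utmConfig (s' := .updateState) (p' := 5 * N) (j' := 0)
      (g' := stagingTape .X (.st q') (.dir .S)) (v' := v) (a' := b),
    detStep_utmConfig (s' := .updateDir) (p' := 5 * N) (j' := 1)
      (g' := stagingTape .X .X (.dir .S)) (v' := q') (a' := b),
    detStep_utmConfig]
  case hg => exact update_stagingTape_right _ _ _ _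
  case hg => exact update_stagingTape_middle _ _ _ _
  case hg => exact update_stagingTape_left _ _ _ _
  all_goals
    simp [utmNext, utmMove, utmWrite, utmRead, Dir.shift, hX, stagingTape, sub_eq_add_neg]

/-- The rewinding of the description tape. -/
theorem detStep_rewind (g : ℤ → UTMSymbol A Q) (n : ℕ) (hn : n ≤ 5 * N) :
    (utm A Q).detStep^[n + 1] (utmConfig (detDescr e b q') W .resetDescr (n - 1) 0 g v a) =
      utmConfig (detDescr e b q') W .compSymbol 0 0 g v a := by
  induction n with
  | zero =>
    have hX := detDescr_left e b q'
    rw [zero_add, Function.iterate_one]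
    apply detStep_utmConfig <;> simp [utmNext, utmMove, utmWrite, utmRead, Dir.shift, hX]
  | succ n ih =>
    have hX : detDescr e b q' n ≠ .X := detDescr_ne_X e b q' (by omega) (by omega)
    rw [Function.iterate_succ_apply, ← ih (by omega)]
    congr 1
    apply detStep_utmConfig <;>
      simp [utmNext, utmMove, utmWrite, utmRead, Dir.shift, hX, sub_eq_add_neg]

theorem detStep_period :
    (utm A Q).detStep^[10 * N + 5]
        (utmConfig (detDescr e b q') W .compSymbol 0 0 (stagingTape .X .X .X) v a) =
      utmConfig (detDescr e b q') W .compSymbol 0 0 (stagingTape .X .X .X) q' b := by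
  rw [show 10 * N + 5 = (5 * N + 1) + (4 + 5 * N) by ring, Function.iterate_add_apply,
    Function.iterate_add_apply _ 4, detStep_scan, detStep_update]
  simpa using detStep_rewind e b q' W q' b (stagingTape .X .X .X) (5 * N) le_rfl

theorem detStep_periods (t : ℕ) (ht : 1 ≤ t) :
    (utm A Q).detStep^[(10 * N + 5) * t]
        (utmConfig (detDescr e b q') W .compSymbol 0 0 (stagingTape .X .X .X) v a) =
      utmConfig (detDescr e b q') W .compSymbol 0 0 (stagingTape .X .X .X) q' b := by
  rw [Function.iterate_mul]
  induction t, ht using Nat.le_induction with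
  | base => rw [Function.iterate_one, detStep_period]
  | succ t _ ih => rw [Function.iterate_succ_apply', ih, detStep_period]

end Run

/-! ### Positivity of the model in the interior -/

section Interior

variable {A Q : Type*} [DecidableEq A] [DecidableEq Q] {N : ℕ}

theorem pointDist_nonneg {Γ : Type*} [DecidableEq Γ] (γ γ' : Γ) :
    (0 : ℝ) ≤ pointDist γ γ' := by
  unfold pointDist
  split_ifs
  exacts [zero_le_one, le_rfl]

theorem pointDist_pos {Γ : Type*} [DecidableEq Γ] {γ γ' : Γ} (h : γ' = γ) :
    (0 : ℝ) < pointDist γ γ' := by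
  simp [pointDist, h]

theorem initConfig_nonneg (b : A) (init : Q) (e : Fin N ≃ A × Q) (x : List A)
    {w : Coord A Q → ℝ} (hw : ∀ i, 0 ≤ w i) : (initConfig b init e x w).Nonneg := by
  have htuple : ∀ p j γ, 0 ≤ tupleSquare w p j γ := by
    intro p j γ
    unfold tupleSquare
    split
    · exact pointDist_nonneg _ _
    · exact pointDist_nonneg _ _
    · cases γ <;> simp [liftSym, hw]
    · cases γ <;> simp [liftSt, hw]
    · cases γ <;> simp [liftDir, hw]
  refine ⟨fun k u γ => ?_, fun s => pointDist_nonneg _ _⟩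
  cases k
  · simp only [initConfig, descrTape]
    split_ifs
    exacts [pointDist_nonneg _ _, htuple _ _ _, pointDist_nonneg _ _]
  all_goals exact pointDist_nonneg _ _

theorem initConfig_supports (b : A) (init q' : Q) (e : Fin N ≃ A × Q) (x : List A)
    {w : Coord A Q → ℝ} (hw : ∀ i, 0 < w i) :
    (initConfig b init e x w).Supports (utmConfig (detDescr e b q')
      (fun u => .sym (if 0 ≤ u then x.getD u.toNat b else b)) .compSymbol 0 0
      (stagingTape .X .X .X) init (x.getD 0 b)) := by
  refine ⟨fun k u => ?_, by simp [initConfig, utmConfig, pointDist]⟩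
  cases k <;> simp only [initConfig, utmConfig, zero_add]
  · simp only [descrTape, detDescr]
    split_ifs
    · exact pointDist_pos rfl
    · generalize (u % 5).toNat = m
      match m with
      | 0 => exact pointDist_pos rfl
      | 1 => exact pointDist_pos rfl
      | 2 => exact hw _
      | 3 => exact hw _
      | _ + 4 => exact hw _
    · exact pointDist_pos rfl
  · refine pointDist_pos ?_
    simp only [stagingTape]
    split_ifs <;> first | rfl | omega
  · exact pointDist_pos (by simp [Function.update_apply])
  · refine pointDist_pos ?_
    by_cases hu : u = 0 <;> simp [hu]

variable [Fintype A] [Fintype Q]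

/-- In the interior of the parameter space every state has positive probability after at least one
simulated step. -/
theorem deltaStep_pos (b : A) (init : Q) (e : Fin N ≃ A × Q) {t : ℕ} (ht : 1 ≤ t) (x : List A)
    {w : Coord A Q → ℝ} (hw : ∀ i, 0 < w i) (q' : Q) : 0 < deltaStep b init e t x w q' := by
  have h := (initConfig_supports b init q' e x hw).iterate
    (initConfig_nonneg b init e x fun i => (hw i).le) (utm A Q) ((10 * N + 5) * t)
  rw [detStep_periods _ _ _ _ _ _ t ht] at h
  simpa [utmConfig, deltaStep] using h.1 .state 0

theorem solutionSet_subset_paramBoundary (hQ : 1 < Fintype.card Q) (b : A) (init : Q)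
    (e : Fin N ≃ A × Q) {t : ℕ} (ht : 1 ≤ t) (q : PMF (List A × Q)) (hdet : IsDeterministic q) :
    solutionSet b init e t q ⊆ paramBoundary A Q := by
  rintro w ⟨hw, hK⟩
  refine ⟨hw, ?_⟩
  by_contra! hne
  have hpos : ∀ i, 0 < w i := by
    rintro ⟨p, a | s | d⟩
    exacts [lt_of_le_of_ne ((hw p).1.1 a) (hne _).symm,
      lt_of_le_of_ne ((hw p).2.1.1 s) (hne _).symm, lt_of_le_of_ne ((hw p).2.2.1 d) (hne _).symm]
  obtain ⟨f, hf⟩ := hdet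
  obtain ⟨x, hx⟩ := exists_inputProb_ne_zero q
  have : Nontrivial Q := Fintype.one_lt_card_iff_nontrivial.1 hQ
  obtain ⟨q', hq'⟩ := exists_ne (f x)
  have h := (klLoss_eq_zero_iff b init e t q w).1 hK x hx q'
  rw [condProb_eq_zero q hx (hf x hx) hq'] at h
  exact (ENNReal.ofReal_pos.2 (deltaStep_pos b init e ht x hpos q')).ne h

end Interior

end Synthesis

theorem mainTheorem2 {A Q : Type*} [Fintype A] [DecidableEq A] [Fintype Q] [DecidableEq Q]
    (hQ : 1 < Fintype.card Q) (b : A) (init : Q) {N : ℕ} (e : Fin N ≃ A × Q)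
    (t : ℕ) (ht : 1 ≤ t) (q : PMF (List A × Q)) (hdet : Synthesis.IsDeterministic q)
    (X : Finset (List A)) (hunif : Synthesis.IsUniformOn q X) :
    Synthesis.IsSemialgebraic (Synthesis.solutionSet b init e t q) ∧
      Synthesis.solutionSet b init e t q ⊆ Synthesis.paramBoundary A Q := by
  obtain ⟨c, -, hX⟩ := hunif
  exact ⟨Synthesis.isSemialgebraic_solutionSet b init e t q X hX,
    Synthesis.solutionSet_subset_paramBoundary hQ b init e ht q hdet⟩
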